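/- Asymmetric hub model. The nodes are $1,\dots,n$ and the first $n_L\le n$ of them are the leaders. The parameters are a probability vector $\rho=(\rho_1,\dots,\rho_{n_L})$ and a matrix $A\in[0,1]^{n_L\times n}$ with $A_{ii}=1$ for $i\le n_L$. For $t=1,\dots,T$ independently, a hub $z_*^{(t)}\in\{1,\dots,n_L\}$ is drawn with $\mathbb P(z_*^{(t)}=i)=\rho_i$, and given $z_*^{(t)}=i$ the indicators $G^{(t)}_j\in\{0,1\}$, $j=1,\dots,n$, are independent with $\mathbb P(G^{(t)}_j=1\mid z_*^{(t)}=i)=A_{ij}$. For a label vector $z\in\{1,\dots,n_L\}^T$ let $$L_G(A\mid z)=\sum_{t=1}^T\sum_{j=1}^n G^{(t)}_j\log A_{z^{(t)}j}+(1-G^{(t)}_j)\log(1-A_{z^{(t)}j}),\qquad L_G(z)=\max_A L_G(A\mid z),$$ with $\log 0=-\infty$ and $0\log 0=0$, where the maximum is over all $A\in[0,1]^{n_L\times n}$ with $A_{ii}=1$ for $i\le n_L$ (so that $L_G(z)=-\infty$ unless $G^{(t)}_{z^{(t)}}=1$ for all $t$). Let $\hat z$ be any maximizer of $L_G(z)$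 over $z$, and let $T_e=\#\{t: z_*^{(t)}\ne\hat z^{(t)}\}$. Let $n_L$, $n$, $T$ tend to infinity jointly, where $\rho$, $A$, $d>0$ and $v>0$ may vary with them. Suppose that there are positive constants $c_{\min},c_{\max},c_0$, which do not vary, such that (a) $c_{\min}/n_L\le\rho_i\le c_{\max}/n_L$ for all $i\le n_L$; (b) for each $i\le n_L$ there is a set $V_i\subset\{1,\dots,n\}$ with $|V_i|\ge vn/n_L$ and $A_{ij}-A_{i'j}\ge d$ for all $j\in V_i$ and all $i'\ne i$, $i'\le n_L$; (c) $A_{ii'}\le c_0/n_L$ for all $i\ne i'$ with $i,i'\le n_L$. If $$\frac{n_L^2\log n_L}{T}=o(1),\qquad \frac{n_L^3\log T}{d^2vT}=o(1),\qquad \frac{n_L^4\log n_L}{d^4v^2n}=o(1),$$ then $n_LT_e/T=o_p(1)$, that is, $\mathbb P(n_LT_e/T\ge\varepsilon)\to0$ for every $\varepsilon>0$. -/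

import Mathlib

open Filter Topology MeasureTheory

noncomputable section

namespace HubModel

/-- `A` is an admissible parameter matrix of the asymmetric hub model with nodes `Fin n` whose
first `nL` nodes are the leaders: its entries are probabilities, and a hub appears in every group
that it forms (`A i i = 1`, the column of leader `i` being `Fin.castLE h i`). -/
structure IsLinkMatrix {nL n : ℕ} (h : nL ≤ n) (A : Fin nL → Fin n → ℝ) : Prop where
  nonneg : ∀ i j, 0 ≤ A i j
  le_one : ∀ i j, A i j ≤ 1
  hub_mem : ∀ i, A i (Fin.castLE h i) = 1

/-- `ρ` is a probability vector. -/
structure IsHubDistribution {nL : ℕ} (ρ : Fin nL → ℝ) : Prop where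
  nonneg : ∀ i, 0 ≤ ρ i
  sum_eq_one : ∑ i, ρ i = 1

/-- The probability `ℙ(G = g, z⋆ = z | A, ρ)` of the hub labels `z` and the groups `g`: the `T`
pairs are independent, the hub of group `t` is `i` with probability `ρ i`, and given hub `i` the
nodes `j` appear independently with probabilities `A i j`. -/
def jointMass {nL n T : ℕ} (ρ : Fin nL → ℝ) (A : Fin nL → Fin n → ℝ)
    (z : Fin T → Fin nL) (g : Fin T → Fin n → Bool) : ℝ :=
  ∏ t, (ρ (z t) * ∏ j, if g t j then A (z t) j else 1 - A (z t) j)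

/-- The random hub labels `Z` and the random groups `G` on `(Ω, μ)` form a sample of size `T` from
the asymmetric hub model with parameters `ρ` and `A`. -/
structure IsSample {Ω : Type*} [MeasurableSpace Ω] (μ : Measure Ω) {nL n T : ℕ}
    (ρ : Fin nL → ℝ) (A : Fin nL → Fin n → ℝ)
    (Z : Ω → Fin T → Fin nL) (G : Ω → Fin T → Fin n → Bool) : Prop where
  measurable_hubs : Measurable Z
  measurable_groups : Measurable G
  law : ∀ z g, μ {ω | Z ω = z ∧ G ω = g} = ENNReal.ofReal (jointMass ρ A z g)

/-- The logarithm of a probability, with `log 0 = -∞`. -/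
def logProb (p : ℝ) : EReal := ENNReal.log (ENNReal.ofReal p)

/-- The log-likelihood `L_G(A | z)` of the groups `g` given the hub labels `z`, that is
`∑ t, ∑ j, g t j * log A (z t) j + (1 - g t j) * log (1 - A (z t) j)`, where `0 * log 0 = 0`. -/
def logLik {nL n T : ℕ} (g : Fin T → Fin n → Bool) (A : Fin nL → Fin n → ℝ)
    (z : Fin T → Fin nL) : EReal :=
  ∑ t, ∑ j, if g t j then logProb (A (z t) j) else logProb (1 - A (z t) j)

/-- The profile log-likelihood `L_G(z)`: the largest value of `L_G(A | z)` over the admissible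
parameter matrices `A`. It is `-∞` if some group `t` does not contain its label `z t`. -/
def profileLogLik {nL n T : ℕ} (h : nL ≤ n) (g : Fin T → Fin n → Bool)
    (z : Fin T → Fin nL) : EReal :=
  ⨆ A : {A : Fin nL → Fin n → ℝ // IsLinkMatrix h A}, logLik g A.1 z

/-- `zhat` is a maximum profile likelihood estimate of the hub labels of the groups `g`. -/
def IsMaxProfileLik {nL n T : ℕ} (h : nL ≤ n) (g : Fin T → Fin n → Bool)
    (zhat : Fin T → Fin nL) : Prop :=
  ∀ z : Fin T → Fin nL, profileLogLik h g z ≤ profileLogLik h g zhat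

/-- The number `T_e` of groups with an incorrect hub label. -/
def numErrors {nL T : ℕ} (z zhat : Fin T → Fin nL) : ℕ :=
  (Finset.univ.filter fun t => z t ≠ zhat t).card

/-- Every leader `i` has a set of at least `v * n / nL` nodes, each of which prefers groups of hub
`i` to groups of any other hub by a margin of at least `d`. -/
def Separated {nL n : ℕ} (A : Fin nL → Fin n → ℝ) (d v : ℝ) : Prop :=
  ∀ i : Fin nL, ∃ V : Finset (Fin n), v * n / nL ≤ (V.card : ℝ) ∧
    ∀ j ∈ V, ∀ i' : Fin nL, i' ≠ i → d ≤ A i j - A i' j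

end HubModel

end

/-!
A leader `i` who is the estimated hub of a group is a member of it. Hence the groups of hub `k` with
the estimated hub `i ≠ k` are among those that leader `i` joined, which by Chernoff's bound are few
in comparison with the groups of hub `i`. When the confusion matrix is dominated by its row sums in
this way, an estimate with `M` errors is at squared distance at least `d² v n M / (4 n_L)` from the
true probabilities, whatever parameters accompany it. A fixed alternative at squared distance `D` is
at least as likely as the truth with probability at most `exp (-D / 4)`, by the Bhattacharyya
coefficient. The profile likelihood is attained at empirical frequencies, of which there are at most
`(T + 1) ^ (n n_L)` for each label vector, so a union bound costs
`T log n_L + n n_L log (T + 1)` in the exponent. For `M = ε T / n_L` this is negligible against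
`d² v n T ε / n_L²`.
-/

namespace HubModel

open Finset

section Confusion

variable {τ ι : Type*} [Fintype τ] [DecidableEq ι]

/-- The confusion matrix of the labels `z` and the labels `zh`: the number of indices labelled `k`
by `z` and `i` by `zh`. -/
def confusion (z zh : τ → ι) (k i : ι) : ℕ := #{t | z t = k ∧ zh t = i}

variable [Fintype ι]

lemma sum_confusion_mul (z zh : τ → ι) (f : ι → ι → ℝ) :
    ∑ i, ∑ k, confusion z zh k i * f k i = ∑ t, f (z t) (zh t) := by
  rw [← sum_fiberwise univ zh]
  refine sum_congr rfl fun i _ => ?_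
  rw [← sum_fiberwise _ z]
  refine sum_congr rfl fun k _ => ?_
  rw [filter_filter, sum_congr rfl (g := fun _ => f k i), sum_const, nsmul_eq_mul, confusion]
  · simp only [and_comm]
  · rintro t ht
    rw [(mem_filter.1 ht).2.1, (mem_filter.1 ht).2.2]

lemma card_filter_eq_sum_confusion (z zh : τ → ι) (k : ι) :
    #{t | z t = k} = ∑ i, confusion z zh k i := by
  rw [card_eq_sum_card_fiberwise (f := zh) (t := univ) (fun _ _ => mem_coe.2 (mem_univ _))]
  simp only [filter_filter, confusion]

lemma numErrors_eq_sum_confusion {L T : ℕ} (z zh : Fin T → Fin L) :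
    (numErrors z zh : ℝ) = ∑ i, ∑ k ∈ univ.erase i, (confusion z zh k i : ℝ) := by
  have h := sum_confusion_mul z zh fun k i => if k ≠ i then 1 else 0
  rw [sum_boole] at h
  rw [numErrors, ← h]
  refine sum_congr rfl fun i _ => ?_
  simp only [mul_ite, mul_one, mul_zero, ← sum_filter, filter_ne']

/-- If `κ` moves column `i` off the diagonal, then the weight of row `i` lies off the entries
`(κ j, j)`, apart from those in other moved columns, which are at most half of their row sums. -/
lemma sum_offDiag_le_two_mul_sum_erase (N : ι → ι → ℝ) (hN : ∀ k i, 0 ≤ N k i)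
    (hdom : ∀ k i, k ≠ i → 2 * N k i ≤ ∑ j, N i j) (κ : ι → ι) :
    ∑ i, ∑ k ∈ univ.erase i, N k i ≤ 2 * ∑ i, ∑ k ∈ univ.erase (κ i), N k i := by
  set r : ι → ℝ := fun i => ∑ j, N i j
  set moved : Finset ι := {i | κ i ≠ i} with hmoved
  have column_le (i : ι) (S : Finset ι) (hS : κ i = i → i ∉ S) :
      ∑ k ∈ S, N k i ≤ ∑ k ∈ univ.erase (κ i), N k i + if κ i ≠ i then r i / 2 else 0 := by
    split_ifs with hi
    · calc ∑ k ∈ S, N k i ≤ ∑ k, N k i :=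
            sum_le_sum_of_subset_of_nonneg (subset_univ S) fun k _ _ => hN k i
        _ = ∑ k ∈ univ.erase (κ i), N k i + N (κ i) i :=
            (sum_erase_add _ _ (mem_univ (κ i))).symm
        _ ≤ _ := by linarith [hdom (κ i) i hi]
    · rw [not_not] at hi
      rw [add_zero, hi]
      exact sum_le_sum_of_subset_of_nonneg (subset_erase.2 ⟨subset_univ S, hS hi⟩)
        fun k _ _ => hN k i
  have sum_le (S : ι → Finset ι) (hS : ∀ i, κ i = i → i ∉ S i) :
      ∑ i, ∑ k ∈ S i, N k i ≤
        ∑ i, ∑ k ∈ univ.erase (κ i), N k i + (∑ i ∈ moved, r i) / 2 := by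
    refine (sum_le_sum fun i _ => column_le i (S i) (hS i)).trans_eq ?_
    rw [sum_add_distrib, ← sum_filter, sum_div]
  have moved_rows : ∑ i ∈ moved, r i ≤
      ∑ i, ∑ k ∈ univ.erase (κ i), N k i + (∑ i ∈ moved, r i) / 2 := by
    refine sum_comm.trans_le (sum_le (fun _ => moved) fun i hi => ?_)
    simp [hmoved, hi]
  linarith [sum_le univ.erase fun i _ => notMem_erase i univ]

end Confusion

section Separation

variable {ι ν : Type*} {A : ι → ν → ℝ} {d : ℝ} {V : ι → Finset ν}

lemma disjoint_of_margin (hd : 0 < d)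
    (hV : ∀ k, ∀ j ∈ V k, ∀ k', k' ≠ k → d ≤ A k j - A k' j) {k k' : ι} (hne : k ≠ k') :
    Disjoint (V k) (V k') :=
  disjoint_left.2 fun j hj hj' => by linarith [hV k j hj k' hne.symm, hV k' j hj' k hne]

lemma weight_mul_sq_le_sum_mul_sq [Fintype ι] {x w : ι → ℝ} (hw : ∀ k, 0 ≤ w k) {k κ : ι}
    (hne : k ≠ κ) (hκ : w k ≤ w κ) (hd : 0 ≤ d) (hx : d ≤ x k - x κ) (b : ℝ) :
    w k * (d ^ 2 / 2) ≤ ∑ k', w k' * (x k' - b) ^ 2 := by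
  classical
  have hsq : d ^ 2 / 2 ≤ (x k - b) ^ 2 + (x κ - b) ^ 2 := by
    have := pow_le_pow_left₀ hd hx 2
    linarith [sq_nonneg ((x k - b) + (x κ - b))]
  calc w k * (d ^ 2 / 2) ≤ w k * (x k - b) ^ 2 + w k * (x κ - b) ^ 2 := by
        rw [← mul_add]; exact mul_le_mul_of_nonneg_left hsq (hw k)
    _ ≤ w k * (x k - b) ^ 2 + w κ * (x κ - b) ^ 2 := by gcongr
    _ = ∑ k' ∈ {k, κ}, w k' * (x k' - b) ^ 2 :=
        (sum_pair (f := fun k' => w k' * (x k' - b) ^ 2) hne).symm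
    _ ≤ _ := sum_le_sum_of_subset_of_nonneg (subset_univ _)
        fun k' _ _ => mul_nonneg (hw k') (sq_nonneg _)

lemma mul_sum_erase_le_sum_mul_sq [Fintype ι] [DecidableEq ι] [Fintype ν] (hd : 0 < d)
    (hV : ∀ k, ∀ j ∈ V k, ∀ k', k' ≠ k → d ≤ A k j - A k' j) {m : ℝ}
    (hm : ∀ k, m ≤ #(V k)) {w : ι → ℝ} (hw : ∀ k, 0 ≤ w k) {κ : ι} (hκ : ∀ k, w k ≤ w κ)
    (b : ν → ℝ) :
    m * d ^ 2 / 2 * ∑ k ∈ univ.erase κ, w k ≤ ∑ k, w k * ∑ j, (A k j - b j) ^ 2 := by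
  classical
  calc m * d ^ 2 / 2 * ∑ k ∈ univ.erase κ, w k
      = ∑ k ∈ univ.erase κ, m * (w k * (d ^ 2 / 2)) := by
        rw [mul_sum]; exact sum_congr rfl fun k _ => by ring
    _ ≤ ∑ k ∈ univ.erase κ, #(V k) * (w k * (d ^ 2 / 2)) := by
        gcongr with k
        · exact mul_nonneg (hw k) (by positivity)
        · exact hm k
    _ ≤ ∑ k ∈ univ.erase κ, ∑ j ∈ V k, ∑ k', w k' * (A k' j - b j) ^ 2 := by
        refine sum_le_sum fun k hk => ?_
        have hne := ne_of_mem_erase hk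
        rw [← nsmul_eq_mul]
        exact card_nsmul_le_sum _ _ _ fun j hj => weight_mul_sq_le_sum_mul_sq (x := (A · j)) hw hne
          (hκ k) hd.le (hV k j hj κ hne.symm) (b j)
    _ = ∑ j ∈ (univ.erase κ).biUnion V, ∑ k', w k' * (A k' j - b j) ^ 2 :=
        (sum_biUnion fun _ _ _ _ hne => disjoint_of_margin hd hV hne).symm
    _ ≤ ∑ j, ∑ k', w k' * (A k' j - b j) ^ 2 :=
        sum_le_sum_of_subset_of_nonneg (subset_univ _) fun j _ _ =>
          sum_nonneg fun k' _ => mul_nonneg (hw k') (sq_nonneg _)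
    _ = ∑ k, w k * ∑ j, (A k j - b j) ^ 2 := by
        rw [sum_comm]; simp only [mul_sum]

/-- The squared distance between two matrices of probabilities, rows being groups and columns
nodes; it controls how well the likelihood tells the two apart. -/
def sqDist {τ ν : Type*} [Fintype τ] [Fintype ν] (P Q : τ → ν → ℝ) : ℝ :=
  ∑ t, ∑ j, (P t j - Q t j) ^ 2

lemma Separated.mul_numErrors_le_sqDist {L n T : ℕ} {A : Fin L → Fin n → ℝ} {d v : ℝ}
    (hsep : Separated A d v) (hd : 0 < d) (hv : 0 < v) {z zh : Fin T → Fin L}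
    (hdom : ∀ k i, k ≠ i → 2 * confusion z zh k i ≤ #{t | z t = i}) (B : Fin L → Fin n → ℝ) :
    v * n / L * d ^ 2 / 4 * numErrors z zh ≤ sqDist (A ∘ z) (B ∘ zh) := by
  choose V hcard hmargin using hsep
  have hmax (i : Fin L) : ∃ κ, ∀ k, confusion z zh k i ≤ confusion z zh κ i :=
    have : Nonempty (Fin L) := ⟨i⟩
    Finite.exists_max fun k => confusion z zh k i
  choose κ hκ using hmax
  have herr : (numErrors z zh : ℝ) ≤ 2 * ∑ i, ∑ k ∈ univ.erase (κ i), (confusion z zh k i : ℝ) := by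
    rw [numErrors_eq_sum_confusion]
    refine sum_offDiag_le_two_mul_sum_erase (fun k i => (confusion z zh k i : ℝ))
      (fun k i => Nat.cast_nonneg _) (fun k i hki => ?_) κ
    exact_mod_cast (hdom k i hki).trans_eq (card_filter_eq_sum_confusion z zh i)
  calc v * n / L * d ^ 2 / 4 * numErrors z zh
      ≤ v * n / L * d ^ 2 / 4 * (2 * ∑ i, ∑ k ∈ univ.erase (κ i), (confusion z zh k i : ℝ)) := by
        gcongr
    _ = ∑ i, v * n / L * d ^ 2 / 2 * ∑ k ∈ univ.erase (κ i), (confusion z zh k i : ℝ) := by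
        rw [← mul_sum]; ring
    _ ≤ ∑ i, ∑ k, confusion z zh k i * ∑ j, (A k j - B i j) ^ 2 :=
        sum_le_sum fun i _ => mul_sum_erase_le_sum_mul_sq hd hmargin hcard
          (fun k => Nat.cast_nonneg _) (fun k => Nat.cast_le.2 (hκ i k)) (B i)
    _ = sqDist (A ∘ z) (B ∘ zh) := sum_confusion_mul z zh fun k i => ∑ j, (A k j - B i j) ^ 2

lemma Separated.sq_mul_le {L n : ℕ} {h : L ≤ n} {A : Fin L → Fin n → ℝ} {d v : ℝ}
    (hsep : Separated A d v) (hA : IsLinkMatrix h A) (hd : 0 < d) (hv : 0 < v) (hL : 2 ≤ L) :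
    d ^ 2 * v ≤ L := by
  obtain ⟨V, hcard, hmargin⟩ := hsep ⟨0, by omega⟩
  have hL0 : (0 : ℝ) < L := by exact_mod_cast (by omega : 0 < L)
  have hn0 : (0 : ℝ) < n := by exact_mod_cast (by omega : 0 < n)
  have hd1 : d ≤ 1 := by
    have hV : (0 : ℝ) < #V := lt_of_lt_of_le (by positivity) hcard
    obtain ⟨j, hj⟩ := card_pos.1 (Nat.cast_pos.1 hV)
    linarith [hmargin j hj ⟨1, by omega⟩ (by simp), hA.le_one ⟨0, by omega⟩ j,
      hA.nonneg ⟨1, by omega⟩ j]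
  have hvL : v ≤ L := by
    have hVn : (#V : ℝ) ≤ n := by exact_mod_cast card_finset_fin_le V
    have hvn := hcard.trans hVn
    rw [div_le_iff₀ hL0, mul_comm] at hvn
    exact le_of_mul_le_mul_left hvn hn0
  exact (mul_le_of_le_one_left hv.le (pow_le_one₀ hd.le hd1)).trans hvL

end Separation

section Likelihood

lemma logProb_prod {τ : Type*} (s : Finset τ) (f : τ → ℝ) (hf : ∀ i ∈ s, 0 ≤ f i) :
    logProb (∏ i ∈ s, f i) = ∑ i ∈ s, logProb (f i) := by
  classical
  induction s using Finset.induction with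
  | empty => simp [logProb]
  | insert i s hi ih =>
    rw [prod_insert hi, sum_insert hi, ← ih fun k hk => hf k (mem_insert_of_mem hk), logProb,
      ENNReal.ofReal_mul (hf i (mem_insert_self i s)), ENNReal.log_mul_add]
    rfl

variable {τ ι ν : Type*} [Fintype τ] [Fintype ν]

/-- The probability mass function of the Bernoulli distribution with parameter `p`. -/
def bernoulliMass (p : ℝ) (x : Bool) : ℝ := if x then p else 1 - p

/-- The likelihood of the groups `g` when node `j` joins group `t` with probability `P t j`,
independently. In the hub model with labels `z` this is `P = A ∘ z`; alternatives to the truth need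
not have that form. -/
def groupsLik (P : τ → ν → ℝ) (g : τ → ν → Bool) : ℝ := ∏ t, ∏ j, bernoulliMass (P t j) (g t j)

lemma bernoulliMass_nonneg {p : ℝ} (hp : p ∈ Set.Icc 0 1) (x : Bool) : 0 ≤ bernoulliMass p x := by
  obtain ⟨h0, h1⟩ := hp
  unfold bernoulliMass
  split_ifs <;> linarith

lemma prod_bernoulliMass_nonneg {p : ν → ℝ} (hp : ∀ j, p j ∈ Set.Icc 0 1) (x : ν → Bool) :
    0 ≤ ∏ j, bernoulliMass (p j) (x j) :=
  prod_nonneg fun j _ => bernoulliMass_nonneg (hp j) (x j)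

lemma groupsLik_nonneg {P : τ → ν → ℝ} (hP : ∀ t j, P t j ∈ Set.Icc 0 1) (g : τ → ν → Bool) :
    0 ≤ groupsLik P g :=
  prod_nonneg fun t _ => prod_bernoulliMass_nonneg (hP t) (g t)

lemma IsLinkMatrix.mem_Icc {L n : ℕ} {h : L ≤ n} {A : Fin L → Fin n → ℝ} (hA : IsLinkMatrix h A)
    (i : Fin L) (j : Fin n) : A i j ∈ Set.Icc 0 1 :=
  ⟨hA.nonneg i j, hA.le_one i j⟩

lemma logLik_eq_logProb {L n T : ℕ} (g : Fin T → Fin n → Bool) {B : Fin L → Fin n → ℝ}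
    (hB : ∀ i j, B i j ∈ Set.Icc 0 1) (z : Fin T → Fin L) :
    logLik g B z = logProb (groupsLik (B ∘ z) g) := by
  simp only [groupsLik, Function.comp_apply, logLik]
  rw [logProb_prod _ _ fun t _ => prod_bernoulliMass_nonneg (hB (z t)) (g t)]
  refine sum_congr rfl fun t _ => ?_
  rw [logProb_prod _ _ fun j _ => bernoulliMass_nonneg (hB (z t) j) (g t j)]
  exact sum_congr rfl fun j _ => (apply_ite logProb _ _ _).symm

/-- The tangent inequality `y ≤ exp (y - 1)` at `y = m * x / k`. -/
lemma pow_le_div_pow_mul_exp (k : ℕ) {m x : ℝ} (hm : 0 < m) (hx : 0 ≤ x) :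
    x ^ k ≤ (k / m) ^ k * Real.exp (m * x - k) := by
  rcases Nat.eq_zero_or_pos k with rfl | hk
  · simpa using mul_nonneg hm.le hx
  have hk0 : (k : ℝ) ≠ 0 := Nat.cast_ne_zero.2 hk.ne'
  calc x ^ k = (k / m) ^ k * (m * x / k) ^ k := by
        rw [← mul_pow, div_mul_div_comm, mul_comm (k : ℝ), mul_div_mul_right _ _ hk0,
          mul_div_cancel_left₀ _ hm.ne']
    _ ≤ (k / m) ^ k * Real.exp (m * x / k - 1) ^ k := by
        gcongr
        linarith [Real.add_one_le_exp (m * x / k - 1)]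
    _ = (k / m) ^ k * Real.exp (m * x - k) := by
        rw [← Real.exp_nat_mul]; field_simp

lemma pow_mul_one_sub_pow_le_frequency (k l : ℕ) {p : ℝ} (hp : p ∈ Set.Icc 0 1) :
    p ^ k * (1 - p) ^ l ≤
      (k / ((k + l : ℕ) : ℝ)) ^ k * (1 - k / ((k + l : ℕ) : ℝ)) ^ l := by
  rcases Nat.eq_zero_or_pos (k + l) with h0 | hpos
  · obtain ⟨rfl, rfl⟩ := Nat.add_eq_zero_iff.1 h0
    simp
  set m : ℝ := ((k + l : ℕ) : ℝ) with hm
  have hm0 : 0 < m := Nat.cast_pos.2 hpos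
  have hkl : m = k + l := by rw [hm, Nat.cast_add]
  have hl : 1 - k / m = l / m := by rw [hkl] at hm0 ⊢; field_simp; ring
  calc p ^ k * (1 - p) ^ l
      ≤ ((k / m) ^ k * Real.exp (m * p - k)) * ((l / m) ^ l * Real.exp (m * (1 - p) - l)) :=
        mul_le_mul (pow_le_div_pow_mul_exp k hm0 hp.1)
          (pow_le_div_pow_mul_exp l hm0 (sub_nonneg.2 hp.2))
          (pow_nonneg (sub_nonneg.2 hp.2) l) (by positivity)
    _ = (k / m) ^ k * (l / m) ^ l * Real.exp ((m * p - k) + (m * (1 - p) - l)) := by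
        rw [Real.exp_add]; ring
    _ = (k / m) ^ k * (1 - k / m) ^ l := by
        rw [hl, show (m * p - k) + (m * (1 - p) - l) = 0 by rw [hkl]; ring, Real.exp_zero, mul_one]

section Frequency

variable [DecidableEq ι]

/-- The number of groups with label `i` that contain the node `j`. -/
def memberCount (z : τ → ι) (g : τ → ν → Bool) (i : ι) (j : ν) : ℕ := #{t | z t = i ∧ g t j}

/-- The parameters with the counts `b` divided by the numbers of groups with each label. They are
truncated at `1`, so that arbitrary counts give probabilities, and `0` for a label without groups
(division by zero). -/
noncomputable def frequencyMatrix (z : τ → ι) (b : ι → ν → ℕ) (i : ι) (j : ν) : ℝ :=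
  min 1 (b i j / #{t | z t = i})

omit [Fintype ν] in
lemma frequencyMatrix_mem_Icc (z : τ → ι) (b : ι → ν → ℕ) (i : ι) (j : ν) :
    frequencyMatrix z b i j ∈ Set.Icc 0 1 :=
  ⟨le_min zero_le_one (by positivity), min_le_left _ _⟩

lemma groupsLik_comp_eq_prod_pow [Fintype ι] (B : ι → ν → ℝ) (z : τ → ι) (g : τ → ν → Bool) :
    groupsLik (B ∘ z) g = ∏ i, ∏ j, B i j ^ memberCount z g i j *
      (1 - B i j) ^ (#{t | z t = i} - memberCount z g i j) := by
  rw [groupsLik, ← prod_fiberwise univ z]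
  refine prod_congr rfl fun i _ => ?_
  rw [Finset.prod_comm]
  refine prod_congr rfl fun j _ => ?_
  have hsplit := card_filter_add_card_filter_not (s := {t | z t = i}) fun t => g t j
  rw [filter_filter] at hsplit
  rw [prod_congr rfl (g := fun t => if g t j then B i j else 1 - B i j), prod_ite, prod_const,
    prod_const, filter_filter, memberCount, ← hsplit, Nat.add_sub_cancel_left]
  intro t ht
  rw [← (mem_filter.1 ht).2]
  rfl

lemma groupsLik_comp_le_frequencyMatrix [Finite ι] {B : ι → ν → ℝ}
    (hB : ∀ i j, B i j ∈ Set.Icc 0 1) (z : τ → ι) (g : τ → ν → Bool) :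
    groupsLik (B ∘ z) g ≤ groupsLik (frequencyMatrix z (memberCount z g) ∘ z) g := by
  cases nonempty_fintype ι
  rw [groupsLik_comp_eq_prod_pow, groupsLik_comp_eq_prod_pow]
  have hpos (i : ι) (j : ν) (k l : ℕ) : 0 ≤ B i j ^ k * (1 - B i j) ^ l :=
    mul_nonneg (pow_nonneg (hB i j).1 k) (pow_nonneg (sub_nonneg.2 (hB i j).2) l)
  refine prod_le_prod (fun i _ => prod_nonneg fun j _ => hpos i j _ _) fun i _ =>
    prod_le_prod (fun j _ => hpos i j _ _) fun j _ => ?_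
  have hle : memberCount z g i j ≤ #{t | z t = i} :=
    card_le_card (monotone_filter_right _ fun t _ ht => ht.1)
  have hfreq : frequencyMatrix z (memberCount z g) i j =
      (memberCount z g i j : ℝ) / #{t | z t = i} :=
    min_eq_right (div_le_one_of_le₀ (Nat.cast_le.2 hle) (Nat.cast_nonneg _))
  have key := pow_mul_one_sub_pow_le_frequency (memberCount z g i j)
    (#{t | z t = i} - memberCount z g i j) (hB i j)
  rwa [Nat.add_sub_cancel' hle, ← hfreq] at key

end Frequency

section ProfileLikelihood

variable {L n T : ℕ} {h : L ≤ n} {g : Fin T → Fin n → Bool} {A : Fin L → Fin n → ℝ}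
  {z zh : Fin T → Fin L}

lemma IsMaxProfileLik.logProb_le (hzh : IsMaxProfileLik h g zh) (hA : IsLinkMatrix h A)
    (z : Fin T → Fin L) : logProb (groupsLik (A ∘ z) g) ≤ profileLogLik h g zh := by
  rw [← logLik_eq_logProb g hA.mem_Icc]
  exact (le_iSup (fun B : {B // IsLinkMatrix h B} => logLik g B.1 z) ⟨A, hA⟩).trans (hzh z)

lemma IsMaxProfileLik.hub_mem (hzh : IsMaxProfileLik h g zh) (hA : IsLinkMatrix h A)
    (hpos : 0 < groupsLik (A ∘ z) g) (t : Fin T) : g t (Fin.castLE h (zh t)) = true := by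
  have hbot : ⊥ < logProb (groupsLik (A ∘ z) g) :=
    ENNReal.bot_lt_log_iff.2 (ENNReal.ofReal_pos.2 hpos)
  obtain ⟨⟨B, hB⟩, hlt⟩ := lt_iSup_iff.1 (hbot.trans_le (hzh.logProb_le hA z))
  rw [logLik_eq_logProb g hB.mem_Icc, logProb, ENNReal.bot_lt_log_iff, ENNReal.ofReal_pos] at hlt
  by_contra hg
  refine hlt.ne' (prod_eq_zero (mem_univ t) (prod_eq_zero (mem_univ (Fin.castLE h (zh t))) ?_))
  rw [bernoulliMass, if_neg hg, Function.comp_apply, hB.hub_mem, sub_self]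

lemma IsMaxProfileLik.groupsLik_le (hzh : IsMaxProfileLik h g zh) (hA : IsLinkMatrix h A)
    (z : Fin T → Fin L) :
    groupsLik (A ∘ z) g ≤ groupsLik (frequencyMatrix zh (memberCount zh g) ∘ zh) g := by
  have hle : profileLogLik h g zh ≤
      logProb (groupsLik (frequencyMatrix zh (memberCount zh g) ∘ zh) g) := by
    refine iSup_le fun B => ?_
    rw [logLik_eq_logProb g B.2.mem_Icc]
    exact ENNReal.log_monotone (ENNReal.ofReal_le_ofReal
      (groupsLik_comp_le_frequencyMatrix B.2.mem_Icc zh g))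
  exact (ENNReal.ofReal_le_ofReal_iff
    (groupsLik_nonneg (fun t => frequencyMatrix_mem_Icc zh _ (zh t)) g)).1
    (ENNReal.log_le_log_iff.1 ((hzh.logProb_le hA z).trans hle))

/-- A group labelled `i` by `zh` contains leader `i`, so `zh` confuses hub `k` with `i` only in
groups of hub `k` that leader `i` joined. -/
lemma confusion_le_memberCount (hmem : ∀ t, g t (Fin.castLE h (zh t)) = true)
    (z : Fin T → Fin L) (k i : Fin L) :
    confusion z zh k i ≤ memberCount z g k (Fin.castLE h i) :=
  card_le_card (monotone_filter_right _ fun t _ ht => ⟨ht.1, ht.2 ▸ hmem t⟩)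

end ProfileLikelihood

end Likelihood

section Affinity

variable {ι ν τ X : Type*} [Fintype ι] [Fintype ν] [Fintype τ] [Fintype X]

/-- The Bhattacharyya coefficient of two mass functions, which measures how hard it is to tell them
apart: if `f ≤ f'` at `x`, then `f x` is at most the summand at `x`. -/
noncomputable def affinity (f f' : X → ℝ) : ℝ := ∑ x, √(f x * f' x)

lemma affinity_nonneg (f f' : X → ℝ) : 0 ≤ affinity f f' := sum_nonneg fun _ _ => Real.sqrt_nonneg _

lemma affinity_prod [DecidableEq ι] {f f' : ι → X → ℝ} (hf : ∀ i x, 0 ≤ f i x)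
    (hf' : ∀ i x, 0 ≤ f' i x) :
    affinity (fun x : ι → X => ∏ i, f i (x i)) (fun x => ∏ i, f' i (x i)) =
      ∏ i, affinity (f i) (f' i) := by
  simp only [affinity, Fintype.prod_sum, ← prod_mul_distrib]
  exact sum_congr rfl fun x _ => Real.sqrt_prod _ fun i _ => mul_nonneg (hf i _) (hf' i _)

lemma sq_sub_div_four_le {x y : ℝ} (hx : x ∈ Set.Icc 0 1) (hy : y ∈ Set.Icc 0 1) :
    (x - y) ^ 2 / 4 ≤ x + y - 2 * √(x * y) := by
  have hsx := Real.sq_sqrt hx.1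
  have hsy := Real.sq_sqrt hy.1
  have hsum : (√x + √y) ^ 2 ≤ 2 ^ 2 :=
    pow_le_pow_left₀ (by positivity)
      (by linarith [Real.sqrt_le_one.2 hx.2, Real.sqrt_le_one.2 hy.2]) 2
  calc (x - y) ^ 2 / 4 = (√x - √y) ^ 2 * ((√x + √y) ^ 2 / 4) := by
        rw [← mul_div_assoc, ← mul_pow, mul_comm (√x - √y), ← sq_sub_sq, hsx, hsy]
    _ ≤ (√x - √y) ^ 2 := mul_le_of_le_one_right (sq_nonneg _) (by linarith)
    _ = x + y - 2 * √(x * y) := by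
        rw [sub_sq, hsx, hsy, Real.sqrt_mul hx.1]; ring

lemma affinity_bernoulliMass_le {a b : ℝ} (ha : a ∈ Set.Icc 0 1) (hb : b ∈ Set.Icc 0 1) :
    affinity (bernoulliMass a) (bernoulliMass b) ≤ Real.exp (-(a - b) ^ 2 / 4) := by
  have hmem := sq_sub_div_four_le ha hb
  have hnot := sq_sub_div_four_le (Set.Icc.one_sub_mem ha) (Set.Icc.one_sub_mem hb)
  rw [sub_sub_sub_cancel_left, ← neg_sq, neg_sub] at hnot
  calc affinity (bernoulliMass a) (bernoulliMass b)
      = √(a * b) + √((1 - a) * (1 - b)) := by simp [affinity, bernoulliMass]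
    _ ≤ -(a - b) ^ 2 / 4 + 1 := by linarith
    _ ≤ Real.exp (-(a - b) ^ 2 / 4) := Real.add_one_le_exp _

lemma affinity_groupsLik_le [DecidableEq τ] [DecidableEq ν] {P Q : τ → ν → ℝ}
    (hP : ∀ t j, P t j ∈ Set.Icc 0 1) (hQ : ∀ t j, Q t j ∈ Set.Icc 0 1) :
    affinity (groupsLik P) (groupsLik Q) ≤ Real.exp (-sqDist P Q / 4) := by
  calc affinity (groupsLik P) (groupsLik Q)
      = ∏ t, affinity (fun x : ν → Bool => ∏ j, bernoulliMass (P t j) (x j))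
          (fun x => ∏ j, bernoulliMass (Q t j) (x j)) :=
        affinity_prod (fun t => prod_bernoulliMass_nonneg (hP t))
          fun t => prod_bernoulliMass_nonneg (hQ t)
    _ = ∏ t, ∏ j, affinity (bernoulliMass (P t j)) (bernoulliMass (Q t j)) :=
        prod_congr rfl fun t _ => affinity_prod (fun j => bernoulliMass_nonneg (hP t j))
          fun j => bernoulliMass_nonneg (hQ t j)
    _ ≤ ∏ t, ∏ j, Real.exp (-(P t j - Q t j) ^ 2 / 4) :=
        prod_le_prod (fun t _ => prod_nonneg fun j _ => affinity_nonneg _ _) fun t _ =>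
          prod_le_prod (fun j _ => affinity_nonneg _ _) fun j _ =>
            affinity_bernoulliMass_le (hP t j) (hQ t j)
    _ = Real.exp (-sqDist P Q / 4) := by
        simp only [← Real.exp_sum, sqDist, ← sum_div, sum_neg_distrib]

end Affinity

section GroupMass

variable {ι ν : Type*} [Fintype ν]

/-- The probability that a group has hub `q.1` and consists of the nodes `j` with `q.2 j`. -/
def groupMass (ρ : ι → ℝ) (A : ι → ν → ℝ) (q : ι × (ν → Bool)) : ℝ :=
  ρ q.1 * ∏ j, bernoulliMass (A q.1 j) (q.2 j)

variable [DecidableEq ν]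

lemma sum_prod_bernoulliMass (p : ν → ℝ) : ∑ x : ν → Bool, ∏ j, bernoulliMass (p j) (x j) = 1 := by
  rw [← Fintype.prod_sum]
  exact prod_eq_one fun j _ => by simp [bernoulliMass]

lemma sum_prod_bernoulliMass_mem (p : ν → ℝ) (j : ν) :
    ∑ x : ν → Bool with x j, ∏ k, bernoulliMass (p k) (x k) = p j := by
  have hpi : ({x : ν → Bool | x j} : Finset _) =
      Fintype.piFinset (Function.update (fun _ => univ) j ({true} : Finset Bool)) := by
    ext x
    simp only [mem_filter, mem_univ, true_and, Fintype.mem_piFinset]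
    refine ⟨fun hx k => ?_, fun hx => by simpa using hx j⟩
    rcases eq_or_ne k j with rfl | hk <;> simp [*]
  rw [hpi, ← prod_univ_sum, Fintype.prod_eq_single j]
  · simp [bernoulliMass]
  · intro k hk
    simp [hk, bernoulliMass]

lemma sum_groupMass_hub (ρ : ι → ℝ) (A : ι → ν → ℝ) (k : ι) :
    ∑ q ∈ {k} ×ˢ univ, groupMass ρ A q = ρ k := by
  simp only [sum_product, sum_singleton, groupMass, ← mul_sum, sum_prod_bernoulliMass, mul_one]

lemma sum_groupMass_hub_mem (ρ : ι → ℝ) (A : ι → ν → ℝ) (k : ι) (j : ν) :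
    ∑ q ∈ {k} ×ˢ ({x : ν → Bool | x j} : Finset _), groupMass ρ A q = ρ k * A k j := by
  simp only [sum_product, sum_singleton, groupMass, ← mul_sum, sum_prod_bernoulliMass_mem]

lemma sum_groupMass [Fintype ι] (ρ : ι → ℝ) (A : ι → ν → ℝ) :
    ∑ q, groupMass ρ A q = ∑ i, ρ i := by
  simp only [Fintype.sum_prod_type, groupMass, ← mul_sum, sum_prod_bernoulliMass, mul_one]

end GroupMass

section Sample

variable {Ω : Type*} [MeasurableSpace Ω] {μ : Measure Ω} {L n T : ℕ} {h : L ≤ n} {ρ : Fin L → ℝ}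
  {A : Fin L → Fin n → ℝ} {Z : Ω → Fin T → Fin L} {G : Ω → Fin T → Fin n → Bool}

lemma jointMass_eq_prod_groupMass (ρ : Fin L → ℝ) (A : Fin L → Fin n → ℝ) (z : Fin T → Fin L)
    (g : Fin T → Fin n → Bool) : jointMass ρ A z g = ∏ t, groupMass ρ A (z t, g t) := rfl

lemma jointMass_eq_mul_groupsLik (ρ : Fin L → ℝ) (A : Fin L → Fin n → ℝ) (z : Fin T → Fin L)
    (g : Fin T → Fin n → Bool) : jointMass ρ A z g = (∏ t, ρ (z t)) * groupsLik (A ∘ z) g :=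
  prod_mul_distrib

lemma groupMass_nonneg (hρ : IsHubDistribution ρ) (hA : IsLinkMatrix h A)
    (q : Fin L × (Fin n → Bool)) : 0 ≤ groupMass ρ A q :=
  mul_nonneg (hρ.nonneg q.1) (prod_bernoulliMass_nonneg (hA.mem_Icc q.1) q.2)

lemma jointMass_nonneg (hρ : IsHubDistribution ρ) (hA : IsLinkMatrix h A) (z : Fin T → Fin L)
    (g : Fin T → Fin n → Bool) : 0 ≤ jointMass ρ A z g := by
  rw [jointMass_eq_prod_groupMass]
  exact prod_nonneg fun t _ => groupMass_nonneg hρ hA (z t, g t)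

lemma sum_jointMass_mul_prod (ρ : Fin L → ℝ) (A : Fin L → Fin n → ℝ)
    (w : Fin L × (Fin n → Bool) → ℝ) :
    ∑ z, ∑ g, jointMass ρ A z g * ∏ t : Fin T, w (z t, g t) =
      (∑ q, groupMass ρ A q * w q) ^ T := by
  rw [Fintype.sum_pow, ← (Equiv.arrowProdEquivProdArrow _ _ _).symm.sum_comp,
    Fintype.sum_prod_type]
  simp only [jointMass_eq_prod_groupMass, ← prod_mul_distrib]
  rfl

lemma IsSample.measure_le_sum (hs : IsSample μ ρ A Z G)
    (E : (Fin T → Fin L) → (Fin T → Fin n → Bool) → Prop)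
    {W : (Fin T → Fin L) → (Fin T → Fin n → Bool) → ℝ} (hW : ∀ z g, 0 ≤ W z g)
    (hEW : ∀ z g, E z g → jointMass ρ A z g ≤ W z g) :
    μ {ω | E (Z ω) (G ω)} ≤ ENNReal.ofReal (∑ z, ∑ g, W z g) := by
  classical
  set S : Finset ((Fin T → Fin L) × (Fin T → Fin n → Bool)) := {q | E q.1 q.2}
  calc μ {ω | E (Z ω) (G ω)}
      ≤ μ (⋃ q ∈ S, {ω | Z ω = q.1 ∧ G ω = q.2}) := measure_mono fun ω hω =>
        Set.mem_iUnion₂.2 ⟨(Z ω, G ω), mem_filter.2 ⟨mem_univ _, hω⟩, rfl, rfl⟩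
    _ ≤ ∑ q ∈ S, μ {ω | Z ω = q.1 ∧ G ω = q.2} := measure_biUnion_finset_le _ _
    _ ≤ ∑ q ∈ S, ENNReal.ofReal (W q.1 q.2) := sum_le_sum fun q hq => by
        rw [hs.law]
        exact ENNReal.ofReal_le_ofReal (hEW _ _ (mem_filter.1 hq).2)
    _ ≤ ∑ q : _ × _, ENNReal.ofReal (W q.1 q.2) := sum_le_sum_of_subset (subset_univ S)
    _ = ENNReal.ofReal (∑ z, ∑ g, W z g) := by
        rw [← ENNReal.ofReal_sum_of_nonneg fun q _ => hW _ _, Fintype.sum_prod_type]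

/-- Chernoff's bound for the number of groups in `S`; a negative `θ` bounds the lower tail. -/
lemma IsSample.measure_le_mul_card_le (hs : IsSample μ ρ A Z G) (hρ : IsHubDistribution ρ)
    (hA : IsLinkMatrix h A) (S : Finset (Fin L × (Fin n → Bool))) (θ s : ℝ) :
    μ {ω | s ≤ θ * #{t | (Z ω t, G ω t) ∈ S}} ≤
      ENNReal.ofReal (Real.exp (T * ((Real.exp θ - 1) * ∑ q ∈ S, groupMass ρ A q) - s)) := by
  set w : Fin L × (Fin n → Bool) → ℝ := fun q => if q ∈ S then Real.exp θ else 1 with hw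
  have hw0 (q : Fin L × (Fin n → Bool)) : 0 ≤ w q := by
    rw [hw]
    positivity
  have prod_w (z : Fin T → Fin L) (g : Fin T → Fin n → Bool) :
      ∏ t, w (z t, g t) = Real.exp (θ * #{t | (z t, g t) ∈ S}) := by
    rw [hw, prod_ite, prod_const_one, mul_one, prod_const, ← Real.exp_nat_mul, mul_comm]
  have mean_w : ∑ q, groupMass ρ A q * w q ≤
      Real.exp ((Real.exp θ - 1) * ∑ q ∈ S, groupMass ρ A q) :=
    calc ∑ q, groupMass ρ A q * w q
        = ∑ q, (groupMass ρ A q + if q ∈ S then (Real.exp θ - 1) * groupMass ρ A q else 0) :=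
          sum_congr rfl fun q _ => by simp only [hw]; split_ifs <;> ring
      _ = (Real.exp θ - 1) * ∑ q ∈ S, groupMass ρ A q + 1 := by
          rw [sum_add_distrib, sum_groupMass, hρ.sum_eq_one, sum_ite_mem, univ_inter, ← mul_sum,
            add_comm]
      _ ≤ _ := Real.add_one_le_exp _
  have hW (z : Fin T → Fin L) (g : Fin T → Fin n → Bool) :
      0 ≤ Real.exp (-s) * (jointMass ρ A z g * ∏ t, w (z t, g t)) :=
    mul_nonneg (Real.exp_nonneg _)
      (mul_nonneg (jointMass_nonneg hρ hA z g) (prod_nonneg fun t _ => hw0 _))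
  refine (hs.measure_le_sum (fun z g => s ≤ θ * #{t | (z t, g t) ∈ S}) hW
    fun z g hsz => ?_).trans (ENNReal.ofReal_le_ofReal ?_)
  · rw [prod_w, mul_left_comm, ← Real.exp_add]
    exact le_mul_of_one_le_right (jointMass_nonneg hρ hA z g) (Real.one_le_exp (by linarith))
  · simp only [← mul_sum]
    rw [sum_jointMass_mul_prod, sub_eq_neg_add, Real.exp_add, Real.exp_nat_mul]
    gcongr
    exact sum_nonneg fun q _ => mul_nonneg (groupMass_nonneg hρ hA q) (hw0 q)

lemma IsSample.measure_card_hub_le (hs : IsSample μ ρ A Z G) (hρ : IsHubDistribution ρ)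
    (hA : IsLinkMatrix h A) (k : Fin L) (r : ℝ) :
    μ {ω | (#{t | Z ω t = k} : ℝ) ≤ r} ≤ ENNReal.ofReal (Real.exp (r - T * ρ k / 2)) := by
  have key := hs.measure_le_mul_card_le hρ hA ({k} ×ˢ univ) (-1) (-r)
  rw [sum_groupMass_hub] at key
  simp only [mem_product, mem_singleton, mem_univ, and_true, neg_one_mul, neg_le_neg_iff] at key
  refine key.trans (ENNReal.ofReal_le_ofReal (Real.exp_le_exp.2 ?_))
  have hexp : Real.exp (-1) - 1 ≤ -(1 / 2) := by linarith [Real.exp_neg_one_lt_d9]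
  have := mul_le_mul_of_nonneg_right hexp (mul_nonneg (Nat.cast_nonneg (α := ℝ) T) (hρ.nonneg k))
  linarith

lemma IsSample.measure_le_memberCount_le (hs : IsSample μ ρ A Z G) (hρ : IsHubDistribution ρ)
    (hA : IsLinkMatrix h A) (k : Fin L) (j : Fin n) (a : ℝ) :
    μ {ω | a ≤ memberCount (Z ω) (G ω) k j} ≤
      ENNReal.ofReal (Real.exp (2 * T * (ρ k * A k j) - a)) := by
  have key := hs.measure_le_mul_card_le hρ hA ({k} ×ˢ ({x | x j} : Finset _)) 1 a
  rw [sum_groupMass_hub_mem] at key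
  simp only [mem_product, mem_singleton, mem_filter, mem_univ, true_and, one_mul] at key
  refine key.trans (ENNReal.ofReal_le_ofReal (Real.exp_le_exp.2 ?_))
  have hexp : Real.exp 1 - 1 ≤ 2 := by linarith [Real.exp_one_lt_d9]
  have := mul_le_mul_of_nonneg_right hexp
    (mul_nonneg (Nat.cast_nonneg (α := ℝ) T) (mul_nonneg (hρ.nonneg k) (hA.nonneg k j)))
  linarith

lemma IsSample.measure_card_hub_lt_le (hs : IsSample μ ρ A Z G) (hρ : IsHubDistribution ρ)
    (hA : IsLinkMatrix h A) {k i : Fin L} {j : Fin n} (hkj : ρ k * A k j ≤ ρ i / 32) :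
    μ {ω | #{t | Z ω t = i} < 2 * memberCount (Z ω) (G ω) k j} ≤
      ENNReal.ofReal (2 * Real.exp (-(ρ i * T) / 16)) := by
  have hT : (0 : ℝ) ≤ T := Nat.cast_nonneg T
  have few_hub : μ {ω | (#{t | Z ω t = i} : ℝ) ≤ ρ i * T / 4} ≤
      ENNReal.ofReal (Real.exp (-(ρ i * T) / 16)) := by
    refine (hs.measure_card_hub_le hρ hA i _).trans
      (ENNReal.ofReal_le_ofReal (Real.exp_le_exp.2 ?_))
    linarith [mul_nonneg (hρ.nonneg i) hT]
  have many_members : μ {ω | ρ i * T / 8 ≤ memberCount (Z ω) (G ω) k j} ≤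
      ENNReal.ofReal (Real.exp (-(ρ i * T) / 16)) := by
    refine (hs.measure_le_memberCount_le hρ hA k j _).trans
      (ENNReal.ofReal_le_ofReal (Real.exp_le_exp.2 ?_))
    linarith [mul_le_mul_of_nonneg_right hkj hT]
  rw [two_mul (Real.exp _), ENNReal.ofReal_add (Real.exp_nonneg _) (Real.exp_nonneg _)]
  refine (measure_mono fun ω hω => ?_).trans
    ((measure_union_le _ _).trans (add_le_add few_hub many_members))
  have hlt : (#{t | Z ω t = i} : ℝ) < 2 * memberCount (Z ω) (G ω) k j := by exact_mod_cast hω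
  rcases le_or_gt (#{t | Z ω t = i} : ℝ) (ρ i * T / 4) with hfew | hmany
  · exact Or.inl hfew
  · exact Or.inr (show ρ i * T / 8 ≤ _ by linarith)

lemma IsSample.measure_exists_card_hub_lt_le (hs : IsSample μ ρ A Z G)
    (hρ : IsHubDistribution ρ) (hA : IsLinkMatrix h A)
    (hlead : ∀ k i, k ≠ i → ρ k * A k (Fin.castLE h i) ≤ ρ i / 32) {p : ℝ} (hp : ∀ i, p ≤ ρ i) :
    μ {ω | ∃ k i, k ≠ i ∧ #{t | Z ω t = i} < 2 * memberCount (Z ω) (G ω) k (Fin.castLE h i)} ≤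
      ENNReal.ofReal (2 * L ^ 2 * Real.exp (-(p * T) / 16)) := by
  have hpair (k i : Fin L) :
      μ {ω | k ≠ i ∧ #{t | Z ω t = i} < 2 * memberCount (Z ω) (G ω) k (Fin.castLE h i)} ≤
        ENNReal.ofReal (2 * Real.exp (-(p * T) / 16)) := by
    rcases eq_or_ne k i with rfl | hki
    · simp
    refine (measure_mono fun ω hω => hω.2).trans
      ((hs.measure_card_hub_lt_le hρ hA (hlead k i hki)).trans (ENNReal.ofReal_le_ofReal ?_))
    gcongr
    exact hp i
  simp only [Set.ofPred_exists]
  calc μ (⋃ k, ⋃ i, _) ≤ ∑ _k : Fin L, ∑ _i : Fin L,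
        ENNReal.ofReal (2 * Real.exp (-(p * T) / 16)) :=
        (measure_iUnion_fintype_le μ _).trans (sum_le_sum fun k _ =>
          (measure_iUnion_fintype_le μ _).trans (sum_le_sum fun i _ => hpair k i))
    _ = ENNReal.ofReal (2 * L ^ 2 * Real.exp (-(p * T) / 16)) := by
        simp only [sum_const, card_univ, Fintype.card_fin]
        rw [← ENNReal.ofReal_nsmul, ← ENNReal.ofReal_nsmul, nsmul_eq_mul, nsmul_eq_mul]
        ring_nf

lemma IsSample.ae_groupsLik_ne_zero (hs : IsSample μ ρ A Z G) :
    ∀ᵐ ω ∂μ, groupsLik (A ∘ Z ω) (G ω) ≠ 0 := by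
  simpa [ae_iff] using hs.measure_le_sum (fun z g => groupsLik (A ∘ z) g = 0) (W := fun _ _ => 0)
    (fun _ _ => le_rfl) fun z g hzero => by rw [jointMass_eq_mul_groupsLik, hzero, mul_zero]

lemma IsSample.measure_groupsLik_le (hs : IsSample μ ρ A Z G) (hρ : IsHubDistribution ρ)
    (hA : IsLinkMatrix h A) {Q : Fin T → Fin n → ℝ} (hQ : ∀ t j, Q t j ∈ Set.Icc 0 1) (K : ℝ) :
    μ {ω | K ≤ sqDist (A ∘ Z ω) Q ∧ groupsLik (A ∘ Z ω) (G ω) ≤ groupsLik Q (G ω)} ≤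
      ENNReal.ofReal (Real.exp (-K / 4)) := by
  have hAz (z : Fin T → Fin L) (t : Fin T) (j : Fin n) : (A ∘ z) t j ∈ Set.Icc 0 1 :=
    hA.mem_Icc (z t) j
  have hρz (z : Fin T → Fin L) : 0 ≤ ∏ t, ρ (z t) := prod_nonneg fun t _ => hρ.nonneg (z t)
  set W : (Fin T → Fin L) → (Fin T → Fin n → Bool) → ℝ := fun z g =>
    if K ≤ sqDist (A ∘ z) Q then (∏ t, ρ (z t)) * √(groupsLik (A ∘ z) g * groupsLik Q g) else 0
  have hW (z : Fin T → Fin L) (g : Fin T → Fin n → Bool) : 0 ≤ W z g :=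
    ite_nonneg (mul_nonneg (hρz z) (Real.sqrt_nonneg _)) le_rfl
  refine (hs.measure_le_sum (fun z g => K ≤ sqDist (A ∘ z) Q ∧
    groupsLik (A ∘ z) g ≤ groupsLik Q g) hW fun z g hE => ?_).trans (ENNReal.ofReal_le_ofReal ?_)
  · rw [jointMass_eq_mul_groupsLik, show W z g = _ from if_pos hE.1]
    have hlik := groupsLik_nonneg (hAz z) g
    gcongr
    · exact hρz z
    · exact Real.le_sqrt_of_sq_le (by rw [sq]; exact mul_le_mul_of_nonneg_left hE.2 hlik)
  · have sum_W (z : Fin T → Fin L) : ∑ g, W z g ≤ (∏ t, ρ (z t)) * Real.exp (-K / 4) := by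
      by_cases hK : K ≤ sqDist (A ∘ z) Q
      · simp only [W, if_pos hK, ← mul_sum]
        refine mul_le_mul_of_nonneg_left ((affinity_groupsLik_le (hAz z) hQ).trans
          (Real.exp_le_exp.2 ?_)) (hρz z)
        linarith
      · simp only [W, if_neg hK, sum_const_zero]
        exact mul_nonneg (hρz z) (Real.exp_nonneg _)
    calc ∑ z, ∑ g, W z g ≤ ∑ z : Fin T → Fin L, (∏ t, ρ (z t)) * Real.exp (-K / 4) :=
          sum_le_sum fun z _ => sum_W z
      _ = Real.exp (-K / 4) := by
          rw [← sum_mul, ← Fintype.sum_pow, hρ.sum_eq_one, one_pow, one_mul]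

lemma IsSample.measure_exists_groupsLik_le (hs : IsSample μ ρ A Z G) (hρ : IsHubDistribution ρ)
    (hA : IsLinkMatrix h A) {κ : Type*} [Fintype κ] {Q : κ → Fin T → Fin n → ℝ}
    (hQ : ∀ c t j, Q c t j ∈ Set.Icc 0 1) (K : ℝ) :
    μ {ω | ∃ c, K ≤ sqDist (A ∘ Z ω) (Q c) ∧
        groupsLik (A ∘ Z ω) (G ω) ≤ groupsLik (Q c) (G ω)} ≤
      ENNReal.ofReal (Fintype.card κ * Real.exp (-K / 4)) := by
  rw [Set.ofPred_exists, ← nsmul_eq_mul, ENNReal.ofReal_nsmul, ← card_univ]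
  exact (measure_iUnion_fintype_le μ _).trans
    (sum_le_card_nsmul _ _ _ fun c _ => hs.measure_groupsLik_le hρ hA (hQ c) K)

lemma IsSample.measure_le_numErrors_le (hs : IsSample μ ρ A Z G) (hρ : IsHubDistribution ρ)
    (hA : IsLinkMatrix h A) {zh : Ω → Fin T → Fin L}
    (hzh : ∀ᵐ ω ∂μ, IsMaxProfileLik h (G ω) (zh ω)) {d v : ℝ} (hd : 0 < d) (hv : 0 < v)
    (hsep : Separated A d v) (hlead : ∀ k i, k ≠ i → ρ k * A k (Fin.castLE h i) ≤ ρ i / 32)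
    {p : ℝ} (hp : ∀ i, p ≤ ρ i) (M : ℝ) :
    μ {ω | M ≤ numErrors (Z ω) (zh ω)} ≤ ENNReal.ofReal
      (2 * L ^ 2 * Real.exp (-(p * T) / 16) +
        L ^ T * (T + 1) ^ (n * L) * Real.exp (-(v * n / L * d ^ 2 / 4 * M) / 4)) := by
  set c := v * n / L * d ^ 2 / 4
  have hc : 0 ≤ c := by positivity
  set Q : (Fin T → Fin L) × (Fin L → Fin n → Fin (T + 1)) → Fin T → Fin n → ℝ :=
    fun q => frequencyMatrix q.1 (fun i j => q.2 i j) ∘ q.1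
  have hQ := hs.measure_exists_groupsLik_le hρ hA (Q := Q)
    (fun q t => frequencyMatrix_mem_Icc q.1 _ (q.1 t)) (c * M)
  have hcard : (Fintype.card ((Fin T → Fin L) × (Fin L → Fin n → Fin (T + 1))) : ℝ) =
      L ^ T * (T + 1) ^ (n * L) := by
    simp [pow_mul]
  rw [hcard] at hQ
  rw [ENNReal.ofReal_add (by positivity) (by positivity)]
  refine (measure_mono_ae ?_).trans ((measure_union_le _ _).trans
    (add_le_add (hs.measure_exists_card_hub_lt_le hρ hA hlead hp) hQ))
  filter_upwards [hzh, hs.ae_groupsLik_ne_zero] with ω hmax hne hM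
  refine or_iff_not_imp_left.2 fun hdom => ?_
  have hmem := hmax.hub_mem hA ((groupsLik_nonneg (fun t => hA.mem_Icc (Z ω t)) _).lt_of_ne' hne)
  have hconf (k i : Fin L) (hki : k ≠ i) :
      2 * confusion (Z ω) (zh ω) k i ≤ #{t | Z ω t = i} := by
    refine (Nat.mul_le_mul_left 2 (confusion_le_memberCount hmem (Z ω) k i)).trans ?_
    exact not_lt.1 fun hlt => hdom ⟨k, i, hki, hlt⟩
  have hcount (i : Fin L) (j : Fin n) : memberCount (zh ω) (G ω) i j < T + 1 :=
    Nat.lt_succ_of_le (card_finset_fin_le _)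
  exact ⟨(zh ω, fun i j => ⟨memberCount (zh ω) (G ω) i j, hcount i j⟩),
    (mul_le_mul_of_nonneg_left hM hc).trans (hsep.mul_numErrors_le_sqDist hd hv hconf _),
    hmax.groupsLik_le hA (Z ω)⟩

end Sample

section Rates

lemma log_entropy_le {L T n D ε : ℝ} (hL : 0 < L) (hT : 2 ≤ T) (hn : 0 < n) (hD : 0 < D)
    (hgrid : L ^ 3 * Real.log T / (D * T) ≤ ε / 96)
    (hlabels : L ^ 2 * Real.log L / (D * n) ≤ ε / 48) :
    T * Real.log L + n * L * Real.log (T + 1) ≤ D * n * T * ε / (16 * L ^ 2) - T * Real.log L := by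
  have hT0 : 0 < T := by linarith
  have hlog : Real.log (T + 1) ≤ 2 * Real.log T := by
    rw [← Nat.cast_two, ← Real.log_pow]
    exact Real.log_le_log (by linarith) (by nlinarith)
  rw [div_le_iff₀ (by positivity)] at hgrid hlabels
  have labels_le : T * Real.log L ≤ D * n * T * ε / (48 * L ^ 2) := by
    rw [le_div_iff₀ (by positivity)]
    linarith [mul_le_mul_of_nonneg_left hlabels hT0.le]
  have grid_le : n * L * Real.log (T + 1) ≤ D * n * T * ε / (48 * L ^ 2) :=
    calc n * L * Real.log (T + 1) ≤ n * L * (2 * Real.log T) := by gcongr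
      _ ≤ D * n * T * ε / (48 * L ^ 2) := by
          rw [le_div_iff₀ (by positivity)]
          linarith [mul_le_mul_of_nonneg_left hgrid hn.le]
  have hthird : D * n * T * ε / (16 * L ^ 2) = 3 * (D * n * T * ε / (48 * L ^ 2)) := by ring
  linarith

lemma entropy_mul_exp_neg_le {L T n : ℕ} {D ε : ℝ} (hL : 0 < L) (hT : 2 ≤ T) (hn : 0 < n)
    (hD : 0 < D) (hgrid : (L : ℝ) ^ 3 * Real.log T / (D * T) ≤ ε / 96)
    (hlabels : (L : ℝ) ^ 2 * Real.log L / (D * n) ≤ ε / 48) :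
    (L : ℝ) ^ T * (T + 1) ^ (n * L) * Real.exp (-(D * n * T * ε / (16 * L ^ 2))) ≤
      1 / (L : ℝ) ^ T := by
  have hL0 : (0 : ℝ) < L := Nat.cast_pos.2 hL
  have key := log_entropy_le hL0 (by exact_mod_cast hT) (Nat.cast_pos.2 hn) hD hgrid hlabels
  rw [← Real.exp_log (show (0 : ℝ) < L ^ T * (T + 1) ^ (n * L) by positivity), ← Real.exp_add,
    ← Real.exp_log (show 0 < 1 / (L : ℝ) ^ T by positivity), Real.exp_le_exp,
    Real.log_mul (by positivity) (by positivity), one_div, Real.log_inv, Real.log_pow,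
    Real.log_pow]
  push_cast
  linarith

lemma sq_mul_exp_neg_le {L x : ℝ} (hL : 0 < L) (hx : 0 < x) (K : ℕ)
    (h : Real.log L / x ≤ 1 / (16 * (K + 2))) : L ^ 2 * Real.exp (-x / 16) ≤ 1 / L ^ K := by
  rw [div_le_div_iff₀ hx (by positivity)] at h
  rw [le_div_iff₀ (by positivity), mul_right_comm, ← pow_add, add_comm 2 K,
    ← Real.exp_log (pow_pos hL (K + 2)), ← Real.exp_add, Real.log_pow, Real.exp_le_one_iff]
  push_cast
  linarith

lemma IsSample.measure_le_mul_numErrors_div_le {Ω : Type*} [MeasurableSpace Ω] {μ : Measure Ω}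
    {L n T : ℕ} {h : L ≤ n} {ρ : Fin L → ℝ} {A : Fin L → Fin n → ℝ} {Z : Ω → Fin T → Fin L}
    {G : Ω → Fin T → Fin n → Bool} (hs : IsSample μ ρ A Z G) (hρ : IsHubDistribution ρ)
    (hA : IsLinkMatrix h A) {zh : Ω → Fin T → Fin L}
    (hzh : ∀ᵐ ω ∂μ, IsMaxProfileLik h (G ω) (zh ω)) {d v : ℝ} (hd : 0 < d) (hv : 0 < v)
    (hsep : Separated A d v) (hlead : ∀ k i, k ≠ i → ρ k * A k (Fin.castLE h i) ≤ ρ i / 32)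
    {p : ℝ} (hp0 : 0 < p) (hp : ∀ i, p ≤ ρ i) {ε : ℝ} (hε : 0 < ε) {K : ℕ} (hT : 2 ≤ T)
    (hKT : K ≤ T) (hhubs : Real.log L / (p * T) ≤ 1 / (16 * (K + 2)))
    (hgrid : (L : ℝ) ^ 3 * Real.log T / (d ^ 2 * v * T) ≤ ε / 96)
    (hlabels : (L : ℝ) ^ 2 * Real.log L / (d ^ 2 * v * n) ≤ ε / 48) :
    μ {ω | ε ≤ L * ((numErrors (Z ω) (zh ω) : ℝ) / T)} ≤ ENNReal.ofReal (3 / 2 ^ K) := by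
  rcases le_or_gt L 1 with hL1 | hL1
  · have : Subsingleton (Fin L) := Fin.subsingleton_iff_le_one.2 hL1
    have no_errors (ω : Ω) : numErrors (Z ω) (zh ω) = 0 := by
      simp [numErrors, eq_iff_true_of_subsingleton]
    simp [no_errors, hε.not_ge]
  have hL0 : (0 : ℝ) < L := Nat.cast_pos.2 (by omega)
  have hL2 : (2 : ℝ) ≤ L := by exact_mod_cast hL1
  have hT0 : (0 : ℝ) < T := Nat.cast_pos.2 (by omega)
  have hevent (ω : Ω) : ε ≤ L * ((numErrors (Z ω) (zh ω) : ℝ) / T) ↔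
      ε * T / L ≤ numErrors (Z ω) (zh ω) := by
    rw [← mul_div_assoc, le_div_iff₀ hT0, div_le_iff₀' hL0]
  have hpow : 1 / (L : ℝ) ^ K ≤ 1 / 2 ^ K := by gcongr
  have hubs_le := sq_mul_exp_neg_le hL0 (by positivity) K hhubs
  have labels_le := entropy_mul_exp_neg_le (by omega) hT (by omega) (by positivity) hgrid hlabels
  have hpowT : 1 / (L : ℝ) ^ T ≤ 1 / L ^ K := by
    gcongr
    linarith
  simp only [hevent]
  refine (hs.measure_le_numErrors_le hρ hA hzh hd hv hsep hlead hp _).trans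
    (ENNReal.ofReal_le_ofReal ?_)
  have hexponent : -(v * n / L * d ^ 2 / 4 * (ε * T / L)) / 4 =
      -(d ^ 2 * v * n * T * ε / (16 * L ^ 2)) := by
    field_simp
    ring
  rw [hexponent, mul_assoc 2]
  linarith [show (3 : ℝ) / 2 ^ K = 3 * (1 / 2 ^ K) by ring]

lemma tendsto_zero_of_eventually_le_div_two_pow {f : ℕ → ENNReal} (c : ℝ)
    (hf : ∀ K : ℕ, ∀ᶠ k in atTop, f k ≤ ENNReal.ofReal (c / 2 ^ K)) :
    Tendsto f atTop (𝓝 0) := by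
  refine ENNReal.tendsto_nhds_zero.2 fun δ hδ => ?_
  have hlim : Tendsto (fun K : ℕ => ENNReal.ofReal (c / 2 ^ K)) atTop (𝓝 0) := by
    simpa using ENNReal.tendsto_ofReal
      ((tendsto_pow_atTop_atTop_of_one_lt (one_lt_two (α := ℝ))).const_div_atTop c)
  obtain ⟨K, hK⟩ := (hlim.eventually_le_const hδ).exists
  exact (hf K).mono fun k hk => hk.trans hK

lemma IsHubDistribution.pos {L : ℕ} {ρ : Fin L → ℝ} (hρ : IsHubDistribution ρ) : 0 < L := by
  rcases Nat.eq_zero_or_pos L with rfl | hL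
  · simpa using hρ.sum_eq_one
  · exact hL

variable {nL n T : ℕ → ℕ}

lemma eventually_mul_le_div {hle : ∀ k, nL k ≤ n k} (hnL : Tendsto nL atTop atTop)
    {ρ : ∀ k, Fin (nL k) → ℝ} {A : ∀ k, Fin (nL k) → Fin (n k) → ℝ} {cmin cmax c₀ : ℝ}
    (hcmin : 0 < cmin)
    (hρ : ∀ k i, cmin / (nL k : ℝ) ≤ ρ k i ∧ ρ k i ≤ cmax / (nL k : ℝ)) (hc₀ : 0 < c₀)
    (hlead : ∀ k, ∀ i i' : Fin (nL k), i ≠ i' →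
      A k i (Fin.castLE (hle k) i') ≤ c₀ / (nL k : ℝ)) :
    ∀ᶠ k in atTop, ∀ i i' : Fin (nL k), i ≠ i' →
      ρ k i * A k i (Fin.castLE (hle k) i') ≤ ρ k i' / 32 := by
  filter_upwards [(tendsto_natCast_atTop_atTop.comp hnL).eventually_ge_atTop
    (32 * (cmax * c₀) / cmin)] with k hk i i' hne
  have hL : (0 : ℝ) < nL k := Nat.cast_pos.2 i.pos
  rw [Function.comp_apply, div_le_iff₀ hcmin] at hk
  have hρi : 0 ≤ ρ k i := (div_pos hcmin hL).le.trans (hρ k i).1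
  calc ρ k i * A k i (Fin.castLE (hle k) i') ≤ cmax / nL k * (c₀ / nL k) :=
        (mul_le_mul_of_nonneg_left (hlead k i i' hne) hρi).trans
          (mul_le_mul_of_nonneg_right (hρ k i).2 (by positivity))
    _ ≤ cmin / nL k / 32 := by
        rw [div_mul_div_comm, div_div, div_le_div_iff₀ (by positivity) (by positivity)]
        linarith [mul_le_mul_of_nonneg_right hk hL.le]
    _ ≤ ρ k i' / 32 := by
        gcongr
        exact (hρ k i').1

lemma tendsto_log_div_mul (hL : ∀ k, 0 < nL k) {c : ℝ} (hc : 0 < c)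
    (h : Tendsto (fun k => (nL k : ℝ) ^ 2 * Real.log (nL k) / (T k : ℝ)) atTop (𝓝 0)) :
    Tendsto (fun k => Real.log (nL k) / (c / nL k * T k)) atTop (𝓝 0) := by
  have hlim := h.const_mul (1 / c)
  rw [mul_zero] at hlim
  refine squeeze_zero (fun k => by positivity) (fun k => ?_) hlim
  have hL1 : (1 : ℝ) ≤ nL k := Nat.one_le_cast.2 (hL k)
  calc Real.log (nL k) / (c / nL k * T k)
      = 1 / c * ((nL k : ℝ) ^ 1 * Real.log (nL k) / T k) := by
        have : (0 : ℝ) < nL k := by linarith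
        field_simp
    _ ≤ 1 / c * ((nL k : ℝ) ^ 2 * Real.log (nL k) / T k) := by
        gcongr
        exact one_le_two

lemma tendsto_sq_mul_log_div (hnL : Tendsto nL atTop atTop) {hle : ∀ k, nL k ≤ n k}
    {A : ∀ k, Fin (nL k) → Fin (n k) → ℝ} (hA : ∀ k, IsLinkMatrix (hle k) (A k)) {d v : ℕ → ℝ}
    (hd : ∀ k, 0 < d k) (hv : ∀ k, 0 < v k) (hsep : ∀ k, Separated (A k) (d k) (v k))
    (h : Tendsto (fun k => (nL k : ℝ) ^ 4 * Real.log (nL k) / (d k ^ 4 * v k ^ 2 * (n k : ℝ)))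
      atTop (𝓝 0)) :
    Tendsto (fun k => (nL k : ℝ) ^ 2 * Real.log (nL k) / (d k ^ 2 * v k * n k)) atTop (𝓝 0) := by
  refine squeeze_zero' (Eventually.of_forall fun k => ?_) ?_ h
  · have := hv k
    positivity
  filter_upwards [hnL.eventually_ge_atTop 2] with k hk
  have hL1 : (1 : ℝ) ≤ nL k := Nat.one_le_cast.2 (by omega)
  have hdv : 0 < d k ^ 2 * v k := mul_pos (pow_pos (hd k) 2) (hv k)
  have hratio : 1 ≤ (nL k : ℝ) ^ 2 / (d k ^ 2 * v k) :=
    (one_le_div hdv).2 (((hsep k).sq_mul_le (hA k) (hd k) (hv k) hk).trans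
      (le_self_pow₀ hL1 two_ne_zero))
  calc (nL k : ℝ) ^ 2 * Real.log (nL k) / (d k ^ 2 * v k * n k)
      ≤ (nL k : ℝ) ^ 2 * Real.log (nL k) / (d k ^ 2 * v k * n k) *
          ((nL k : ℝ) ^ 2 / (d k ^ 2 * v k)) :=
        le_mul_of_one_le_right (by positivity) hratio
    _ = (nL k : ℝ) ^ 4 * Real.log (nL k) / (d k ^ 4 * v k ^ 2 * n k) := by
        rw [div_mul_div_comm]
        ring

end Rates

end HubModel

theorem proposition1_general
    (nL n T : ℕ → ℕ) (hle : ∀ k, nL k ≤ n k) (hT : Tendsto T atTop atTop)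
    (ρ : ∀ k, Fin (nL k) → ℝ) (A : ∀ k, Fin (nL k) → Fin (n k) → ℝ)
    (hρ : ∀ k, HubModel.IsHubDistribution (ρ k))
    (hA : ∀ k, HubModel.IsLinkMatrix (hle k) (A k))
    {Ω : ℕ → Type*} [∀ k, MeasurableSpace (Ω k)] (μ : ∀ k, Measure (Ω k))
    (Z : ∀ k, Ω k → Fin (T k) → Fin (nL k))
    (G : ∀ k, Ω k → Fin (T k) → Fin (n k) → Bool)
    (hZG : ∀ k, HubModel.IsSample (μ k) (ρ k) (A k) (Z k) (G k))
    (zhat : ∀ k, Ω k → Fin (T k) → Fin (nL k))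
    (hzhat : ∀ k, ∀ᵐ ω ∂(μ k), HubModel.IsMaxProfileLik (hle k) (G k ω) (zhat k ω))
    (p : ℕ → ℝ) (hp : ∀ k, 0 < p k) (hpρ : ∀ k i, p k ≤ ρ k i)
    (d v : ℕ → ℝ) (hd : ∀ k, 0 < d k) (hv : ∀ k, 0 < v k)
    (hsep : ∀ k, HubModel.Separated (A k) (d k) (v k))
    (hlead : ∀ᶠ k in atTop, ∀ i i' : Fin (nL k), i ≠ i' →
      ρ k i * A k i (Fin.castLE (hle k) i') ≤ ρ k i' / 32)
    (hrate₁ : Tendsto (fun k => Real.log (nL k) / (p k * T k)) atTop (𝓝 0))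
    (hrate₂ : Tendsto (fun k => (nL k : ℝ) ^ 3 * Real.log (T k) / (d k ^ 2 * v k * (T k : ℝ)))
      atTop (𝓝 0))
    (hrate₃ : Tendsto (fun k => (nL k : ℝ) ^ 2 * Real.log (nL k) / (d k ^ 2 * v k * n k))
      atTop (𝓝 0)) :
    ∀ ε : ℝ, 0 < ε →
      Tendsto
        (fun k => μ k {ω | ε ≤ (nL k : ℝ) *
          ((HubModel.numErrors (Z k ω) (zhat k ω) : ℝ) / (T k : ℝ))})
        atTop (𝓝 0) := by
  intro ε hε
  refine HubModel.tendsto_zero_of_eventually_le_div_two_pow 3 fun K => ?_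
  filter_upwards [hlead, hT.eventually_ge_atTop 2, hT.eventually_ge_atTop K,
    hrate₁.eventually_le_const (show 0 < 1 / (16 * ((K : ℝ) + 2)) by positivity),
    hrate₂.eventually_le_const (show 0 < ε / 96 by positivity),
    hrate₃.eventually_le_const (show 0 < ε / 48 by positivity)] with
    k lead_le two_le K_le hubs_le grid_le labels_le
  exact (hZG k).measure_le_mul_numErrors_div_le (hρ k) (hA k) (hzhat k) (hd k) (hv k) (hsep k)
    lead_le (hp k) (hpρ k) hε two_le K_le hubs_le grid_le labels_le

theorem proposition1
    -- the sizes of the hub set, of the node set and of the sample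
    (nL n T : ℕ → ℕ) (hle : ∀ k, nL k ≤ n k)
    (hnL : Tendsto nL atTop atTop) (hn : Tendsto n atTop atTop) (hT : Tendsto T atTop atTop)
    -- the parameters of the model
    (ρ : ∀ k, Fin (nL k) → ℝ) (A : ∀ k, Fin (nL k) → Fin (n k) → ℝ)
    (hρ : ∀ k, HubModel.IsHubDistribution (ρ k))
    (hA : ∀ k, HubModel.IsLinkMatrix (hle k) (A k))
    -- the sample
    {Ω : ℕ → Type*} [∀ k, MeasurableSpace (Ω k)]
    (μ : ∀ k, Measure (Ω k)) [∀ k, IsProbabilityMeasure (μ k)]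
    (Z : ∀ k, Ω k → Fin (T k) → Fin (nL k))
    (G : ∀ k, Ω k → Fin (T k) → Fin (n k) → Bool)
    (hZG : ∀ k, HubModel.IsSample (μ k) (ρ k) (A k) (Z k) (G k))
    -- the maximum profile likelihood estimator
    (zhat : ∀ k, Ω k → Fin (T k) → Fin (nL k))
    (hzhat : ∀ k, ∀ᵐ ω ∂(μ k), HubModel.IsMaxProfileLik (hle k) (G k ω) (zhat k ω))
    -- hub probabilities of the order `1 / nL`
    (cmin cmax : ℝ) (hcmin : 0 < cmin)
    (hρ_bounds : ∀ k i, cmin / (nL k : ℝ) ≤ ρ k i ∧ ρ k i ≤ cmax / (nL k : ℝ))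
    -- separation of the hubs
    (d v : ℕ → ℝ) (hd : ∀ k, 0 < d k) (hv : ∀ k, 0 < v k)
    (hsep : ∀ k, HubModel.Separated (A k) (d k) (v k))
    -- links between leaders
    (c₀ : ℝ) (hc₀ : 0 < c₀)
    (hlead : ∀ k, ∀ i i' : Fin (nL k), i ≠ i' →
      A k i (Fin.castLE (hle k) i') ≤ c₀ / (nL k : ℝ))
    -- rates
    (hrate₁ : Tendsto (fun k => (nL k : ℝ) ^ 2 * Real.log (nL k) / (T k : ℝ)) atTop (𝓝 0))
    (hrate₂ : Tendsto (fun k => (nL k : ℝ) ^ 3 * Real.log (T k) / (d k ^ 2 * v k * (T k : ℝ)))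
      atTop (𝓝 0))
    (hrate₃ : Tendsto
      (fun k => (nL k : ℝ) ^ 4 * Real.log (nL k) / (d k ^ 4 * v k ^ 2 * (n k : ℝ)))
      atTop (𝓝 0)) :
    ∀ ε : ℝ, 0 < ε →
      Tendsto
        (fun k => μ k {ω | ε ≤ (nL k : ℝ) *
          ((HubModel.numErrors (Z k ω) (zhat k ω) : ℝ) / (T k : ℝ))})
        atTop (𝓝 0) := by
  have hL := fun k => (hρ k).pos
  exact proposition1_general nL n T hle hT ρ A hρ hA μ Z G hZG zhat hzhat
    (fun k => cmin / nL k) (fun k => div_pos hcmin (Nat.cast_pos.2 (hL k)))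
    (fun k i => (hρ_bounds k i).1) d v hd hv hsep
    (HubModel.eventually_mul_le_div hnL hcmin hρ_bounds hc₀ hlead)
    (HubModel.tendsto_log_div_mul hL hcmin hrate₁) hrate₂
    (HubModel.tendsto_sq_mul_log_div hnL hA hd hv hsep hrate₃)
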